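/- Let $A$ be a Hermitian unital Banach $*$-algebra, i.e. a complex unital Banach algebra with an involution (not assumed continuous) such that every selfadjoint element has real spectrum. Write $a\ge 0$ if $a^*=a$ and $\sigma(a)\subset[0,\infty)$. Let $\psi:A\to\mathbb C$ be a positive normalized linear functional, i.e. $\psi$ is linear, $\psi(a)\ge 0$ whenever $a\ge 0$, and $\psi(1)=1$. Let $f$ be analytic on an open set $G\subset\mathbb C$, let $I\subset G$ be a real interval, and assume that $f$ is real-valued and convex on $I$. Let $m<M$ be real numbers with $[m,M]\subset I$, and let $c\in A$ be selfadjoint with $\sigma(c)\subseteq[m,M]$. Let $$f(c)=\frac1{2\pi i}\oint_\gamma f(z)(z-c)^{-1}\,dz ,$$ where $\gamma$ is the positively oriented boundary of a closed rectangle contained in $G$ whose interior contains $\sigma(c)$ (this is the analytic functional calculus; the element $f(c)$ does not depend on the choice of such a closed curve). For $t\in(m,M)$ put $$\Theta_f(t;m,M)=\frac{f(M)-f(t)}{M-t}-\frac{f(t)-f(m)}{t-m}.$$ If $\psi(c)\in(m,M)$, then $\psi(f(c))$ is real, $\sup_{t\in(m,M)}\Theta_f(t;m,M)<\infty$, and $$0\le\psi(f(c))-f(\psi(c))\le\frac{(M-\psi(c))(\psi(c)-m)}{M-m}\sup_{t\in(m,M)}\Theta_f(t;m,M)$$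 $$\le\left\{\begin{array}{l}\frac14(M-m)\sup_{t\in(m,M)}\Theta_f(t;m,M)\\[4pt](M-\psi(c))(\psi(c)-m)\,\frac{f'(M)-f'(m)}{M-m}\end{array}\right.\ \le\ \frac14(M-m)\,[f'(M)-f'(m)],$$ where the inequalities hold for each of the two quantities in the brace. Moreover $$0\le\psi(f(c))-f(\psi(c))\le\frac14(M-m)\,\Theta_f(\psi(c);m,M)\le\frac14(M-m)\sup_{t\in(m,M)}\Theta_f(t;m,M)\le\frac14(M-m)\,[f'(M)-f'(m)].$$ -/

import Mathlib

/-- A (complex, unital) `*`-algebra is Hermitian if all its selfadjoint elements have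
real spectrum. -/
def IsHermitianAlgebra (A : Type*) [Ring A] [StarRing A] [Algebra ℂ A] : Prop :=
  ∀ a : A, IsSelfAdjoint a → ∀ z ∈ spectrum ℂ a, z.im = 0

/-- `a ≥ 0` in a unital `*`-algebra: `a` is selfadjoint and `σ(a) ⊆ [0, ∞)`. -/
def IsNonnegElement {A : Type*} [Ring A] [StarRing A] [Algebra ℂ A] (a : A) : Prop :=
  IsSelfAdjoint a ∧ ∀ z ∈ spectrum ℂ a, 0 ≤ z.re ∧ z.im = 0

/-- A linear functional is positive if it takes real nonnegative values on the elements
`a ≥ 0`. No continuity is required. -/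
def IsPositiveFunctional {A : Type*} [Ring A] [StarRing A] [Algebra ℂ A]
    (ψ : A →ₗ[ℂ] ℂ) : Prop :=
  ∀ a : A, IsNonnegElement a → 0 ≤ (ψ a).re ∧ (ψ a).im = 0

/-- The contour integral `∮ F(z) dz` along the boundary of the rectangle with lower left
corner `p` and upper right corner `q`, in the counterclockwise direction. -/
noncomputable def rectangleIntegral {E : Type*} [NormedAddCommGroup E] [NormedSpace ℂ E]
    (F : ℂ → E) (p q : ℂ) : E :=
  (((∫ x : ℝ in p.re..q.re, F (x + p.im * Complex.I)) -
      ∫ x : ℝ in p.re..q.re, F (x + q.im * Complex.I)) +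
      Complex.I • ∫ y : ℝ in p.im..q.im, F (q.re + y * Complex.I)) -
    Complex.I • ∫ y : ℝ in p.im..q.im, F (p.re + y * Complex.I)

/-- `p`, `q` are the lower left and upper right corners of a nondegenerate closed rectangle
which is contained in `G` and has the set `K` in its interior. Thus its boundary is a simple
closed rectifiable curve in `G` with `K` inside it, winding around no point outside `G`. -/
structure IsSurroundingRectangle (G K : Set ℂ) (p q : ℂ) : Prop where
  re_lt : p.re < q.re
  im_lt : p.im < q.im
  subset : Set.Icc p.re q.re ×ℂ Set.Icc p.im q.im ⊆ G
  inside : K ⊆ Set.Ioo p.re q.re ×ℂ Set.Ioo p.im q.im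

open Classical in
/-- The holomorphic functional calculus: for `f` analytic on the open set `G ⊇ σ(a)`,
`f(a) = (2πi)⁻¹ ∮ f(z) (z - a)⁻¹ dz`. The integral does not depend on the closed curve in `G`
surrounding `σ(a)`; here the curve is taken to be the boundary of a rectangle, which is possible
whenever `G` contains a compact interval of the real line that contains `σ(a)`. (If no
rectangle surrounds `σ(a)` within `G`, the value is set to `0`.) -/
noncomputable def holomorphicCalculus {A : Type*} [NormedRing A] [NormedAlgebra ℂ A]
    (G : Set ℂ) (f : ℂ → ℂ) (a : A) : A :=
  if h : ∃ r : ℂ × ℂ, IsSurroundingRectangle G (spectrum ℂ a) r.1 r.2 then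
    (2 * Real.pi * Complex.I : ℂ)⁻¹ •
      rectangleIntegral (fun z => f z • Ring.inverse (algebraMap ℂ A z - a))
        h.choose.1 h.choose.2
  else 0

/-- The function of a real variable given by a complex function `f` which is real on the part
of the real line under consideration. -/
def onReal (f : ℂ → ℂ) (x : ℝ) : ℝ := (f x).re

/-- `Θ_g(t; m, M)`, the difference of the slopes of the chords of `g` over `[t, M]` and
`[m, t]`. -/
noncomputable def chordSlopeDiff (g : ℝ → ℝ) (m M t : ℝ) : ℝ :=
  (g M - g t) / (M - t) - (g t - g m) / (t - m)

/-- `sup_{t ∈ (m, M)} Θ_g(t; m, M)`. -/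
noncomputable def supChordSlopeDiff (g : ℝ → ℝ) (m M : ℝ) : ℝ :=
  sSup (chordSlopeDiff g m M '' Set.Ioo m M)

/-!
Jensen's inequality and its converse for a positive functional on a Hermitian Banach algebra.

A convex `g` on `[m, M]` lies above its tangent at `ψ(c)` and below its chord over `[m, M]`. If the
positive functional `ψ` preserves these two affine inequalities when a real variable is replaced by
`c`, then `ψ(f(c))` lies between `g(ψ(c))` and the value of the chord at `ψ(c)`; the distance of
these two is `(M - ψ(c)) (ψ(c) - m) / (M - m) * Θ(ψ(c))`. The remaining estimates follow from
`(M - s) (s - m) ≤ (M - m)² / 4` and from `Θ ≤ g'(M) - g'(m)`, as chord slopes of a convex function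
are bounded by the derivatives at the end points.

That `ψ` preserves these inequalities (`IsPositiveFunctional.nonneg_affine_add_holomorphicCalculus`)
would be immediate if `f(c)` were selfadjoint. As the involution may be discontinuous, this is not
available. Instead, the argument takes place in the bicommutant `B` of `c`, a closed commutative
subalgebra which contains `c`, is stable under the involution and under inverses, and therefore has
the same spectra as `A`. It contains `f(c)`, and a character `φ` of `B` maps `f(c)` to `f(φ(c))`
by continuity and Cauchy's formula for a rectangle. If `u ∈ B` has `φ(u) ≥ 0` for all characters,
write `u = x + i y` with `x` and `y` selfadjoint. Since `A` is Hermitian, `φ(x)` and `φ(y)` are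
real, so `φ(y) = 0` and `φ(x) = φ(u) ≥ 0` for all `φ`. By Gelfand theory `x`, `y` and `-y` are
nonnegative elements, whence `ψ(y) = 0` and `ψ(u) = ψ(x) ≥ 0`
(`IsPositiveFunctional.nonneg_of_characters`).
-/

/-! ### Integrals along the boundary of a rectangle -/

/-- The boundary of the closed rectangle with lower left corner `p` and upper right corner `q`. -/
def rectangleFrame (p q : ℂ) : Set ℂ :=
  (Set.Icc p.re q.re ×ℂ Set.Icc p.im q.im) \ (Set.Ioo p.re q.re ×ℂ Set.Ioo p.im q.im)

section RectangleIntegral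

variable {E F : Type*} [NormedAddCommGroup E] [NormedSpace ℂ E]
  [NormedAddCommGroup F] [NormedSpace ℂ F] {p q : ℂ}

lemma bottom_mem_rectangleFrame (hi : p.im < q.im) {x : ℝ} (hx : x ∈ Set.Icc p.re q.re) :
    (x + p.im * Complex.I : ℂ) ∈ rectangleFrame p q := by
  simp [rectangleFrame, Complex.mem_reProdIm, hx.1, hx.2, hi.le]

lemma top_mem_rectangleFrame (hi : p.im < q.im) {x : ℝ} (hx : x ∈ Set.Icc p.re q.re) :
    (x + q.im * Complex.I : ℂ) ∈ rectangleFrame p q := by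
  simp [rectangleFrame, Complex.mem_reProdIm, hx.1, hx.2, hi.le]

lemma left_mem_rectangleFrame (hr : p.re < q.re) {y : ℝ} (hy : y ∈ Set.Icc p.im q.im) :
    (p.re + y * Complex.I : ℂ) ∈ rectangleFrame p q := by
  simp [rectangleFrame, Complex.mem_reProdIm, hy.1, hy.2, hr.le]

lemma right_mem_rectangleFrame (hr : p.re < q.re) {y : ℝ} (hy : y ∈ Set.Icc p.im q.im) :
    (q.re + y * Complex.I : ℂ) ∈ rectangleFrame p q := by
  simp [rectangleFrame, Complex.mem_reProdIm, hy.1, hy.2, hr.le]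

lemma rectangleIntegral_congr (hr : p.re < q.re) (hi : p.im < q.im) {f g : ℂ → E}
    (h : Set.EqOn f g (rectangleFrame p q)) :
    rectangleIntegral f p q = rectangleIntegral g p q := by
  unfold rectangleIntegral
  rw [intervalIntegral.integral_congr (f := fun x : ℝ => f (x + p.im * Complex.I))
      (g := fun x : ℝ => g (x + p.im * Complex.I)),
    intervalIntegral.integral_congr (f := fun x : ℝ => f (x + q.im * Complex.I))
      (g := fun x : ℝ => g (x + q.im * Complex.I)),
    intervalIntegral.integral_congr (f := fun y : ℝ => f (p.re + y * Complex.I))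
      (g := fun y : ℝ => g (p.re + y * Complex.I)),
    intervalIntegral.integral_congr (f := fun y : ℝ => f (q.re + y * Complex.I))
      (g := fun y : ℝ => g (q.re + y * Complex.I))]
  · intro y hy
    rw [Set.uIcc_of_le hi.le] at hy
    exact h (right_mem_rectangleFrame hr hy)
  · intro y hy
    rw [Set.uIcc_of_le hi.le] at hy
    exact h (left_mem_rectangleFrame hr hy)
  · intro y hy
    rw [Set.uIcc_of_le hr.le] at hy
    exact h (top_mem_rectangleFrame hi hy)
  · intro y hy
    rw [Set.uIcc_of_le hr.le] at hy
    exact h (bottom_mem_rectangleFrame hi hy)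

lemma ContinuousOn.intervalIntegrable_sides {X : Type*} [NormedAddCommGroup X] {f : ℂ → X}
    (hf : ContinuousOn f (rectangleFrame p q)) (hr : p.re < q.re) (hi : p.im < q.im) :
    (IntervalIntegrable (fun x : ℝ => f (x + p.im * Complex.I)) MeasureTheory.volume p.re q.re ∧
      IntervalIntegrable (fun x : ℝ => f (x + q.im * Complex.I)) MeasureTheory.volume p.re q.re) ∧
    IntervalIntegrable (fun y : ℝ => f (q.re + y * Complex.I)) MeasureTheory.volume p.im q.im ∧
      IntervalIntegrable (fun y : ℝ => f (p.re + y * Complex.I)) MeasureTheory.volume p.im q.im := by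
  refine ⟨⟨?_, ?_⟩, ?_, ?_⟩ <;> refine ContinuousOn.intervalIntegrable_of_Icc (by order) ?_ <;>
    refine hf.comp (by fun_prop) ?_
  exacts [fun _ h => bottom_mem_rectangleFrame hi h, fun _ h => top_mem_rectangleFrame hi h,
    fun _ h => right_mem_rectangleFrame hr h, fun _ h => left_mem_rectangleFrame hr h]

lemma rectangleIntegral_add (hr : p.re < q.re) (hi : p.im < q.im) {f g : ℂ → E}
    (hf : ContinuousOn f (rectangleFrame p q)) (hg : ContinuousOn g (rectangleFrame p q)) :
    rectangleIntegral (fun z => f z + g z) p q =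
      rectangleIntegral f p q + rectangleIntegral g p q := by
  obtain ⟨⟨f1, f2⟩, f3, f4⟩ := hf.intervalIntegrable_sides hr hi
  obtain ⟨⟨g1, g2⟩, g3, g4⟩ := hg.intervalIntegrable_sides hr hi
  unfold rectangleIntegral
  rw [intervalIntegral.integral_add f1 g1, intervalIntegral.integral_add f2 g2,
    intervalIntegral.integral_add f3 g3, intervalIntegral.integral_add f4 g4]
  module

lemma ContinuousLinearMap.map_rectangleIntegral [CompleteSpace E] [CompleteSpace F] (T : E →L[ℂ] F)
    (hr : p.re < q.re) (hi : p.im < q.im) {f : ℂ → E} (hf : ContinuousOn f (rectangleFrame p q)) :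
    T (rectangleIntegral f p q) = rectangleIntegral (fun z => T (f z)) p q := by
  obtain ⟨⟨f1, f2⟩, f3, f4⟩ := hf.intervalIntegrable_sides hr hi
  unfold rectangleIntegral
  rw [T.intervalIntegral_comp_comm f1, T.intervalIntegral_comp_comm f2,
    T.intervalIntegral_comp_comm f3, T.intervalIntegral_comp_comm f4]
  simp only [map_add, map_sub, map_smul]

/-- The winding number of a rectangle around a point `w` inside it is one. The principal
logarithm of `z - w` is a primitive of `(z - w)⁻¹` on three sides; on the left side, which meets the
branch cut, `Complex.log (w - z)` is used, and the two branches differ by `± π i` at the corners. -/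
lemma rectangleIntegral_inv_sub {w : ℂ}
    (hw : w ∈ Set.Ioo p.re q.re ×ℂ Set.Ioo p.im q.im) :
    rectangleIntegral (fun z => (z - w)⁻¹) p q = 2 * Real.pi * Complex.I := by
  obtain ⟨⟨hw1, hw2⟩, hw3, hw4⟩ := hw
  have hlog : ∀ (a b : ℂ) (x₀ x₁ : ℝ),
      (∀ x ∈ Set.uIcc x₀ x₁, a * x + b ∈ Complex.slitPlane) →
      a * ∫ x in x₀..x₁, (a * x + b)⁻¹ =
        Complex.log (a * x₁ + b) - Complex.log (a * x₀ + b) := by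
    intro a b x₀ x₁ h
    rw [← intervalIntegral.integral_const_mul]
    refine intervalIntegral.integral_eq_sub_of_hasDerivAt
      (f := fun x : ℝ => Complex.log (a * x + b)) (fun x hx => ?_) ?_
    · have h1 : HasDerivAt (fun x : ℝ => a * (x : ℂ) + b) a x := by
        simpa using ((Complex.ofRealCLM.hasDerivAt (x := x)).const_mul a).add_const b
      simpa [div_eq_mul_inv] using h1.clog_real (h x hx)
    · refine ContinuousOn.intervalIntegrable (ContinuousOn.mul continuousOn_const
        (ContinuousOn.inv₀ (by fun_prop) fun x hx => Complex.slitPlane_ne_zero (h x hx)))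
  have e1 := hlog 1 (p.im * Complex.I - w) p.re q.re fun x _ =>
    Or.inr (by simp; linarith)
  have e2 := hlog 1 (q.im * Complex.I - w) p.re q.re fun x _ =>
    Or.inr (by simp; linarith)
  have e3 := hlog Complex.I (q.re - w) p.im q.im fun x _ =>
    Or.inl (by simp; linarith)
  have e4 := hlog (-Complex.I) (w - p.re) p.im q.im fun x _ =>
    Or.inl (by simp; linarith)
  have i1 : ∫ x : ℝ in p.re..q.re, ((x + p.im * Complex.I : ℂ) - w)⁻¹ =
      ∫ x : ℝ in p.re..q.re, (1 * (x : ℂ) + (p.im * Complex.I - w))⁻¹ := by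
    congr 1; ext x; congr 1; ring
  have i2 : ∫ x : ℝ in p.re..q.re, ((x + q.im * Complex.I : ℂ) - w)⁻¹ =
      ∫ x : ℝ in p.re..q.re, (1 * (x : ℂ) + (q.im * Complex.I - w))⁻¹ := by
    congr 1; ext x; congr 1; ring
  have i3 : ∫ y : ℝ in p.im..q.im, ((q.re + y * Complex.I : ℂ) - w)⁻¹ =
      ∫ y : ℝ in p.im..q.im, (Complex.I * (y : ℂ) + (q.re - w))⁻¹ := by
    congr 1; ext x; congr 1; ring
  have i4 : ∫ y : ℝ in p.im..q.im, ((p.re + y * Complex.I : ℂ) - w)⁻¹ =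
      - ∫ y : ℝ in p.im..q.im, (-Complex.I * (y : ℂ) + (w - p.re))⁻¹ := by
    rw [← intervalIntegral.integral_neg]
    congr 1; ext x; rw [← inv_neg]; congr 1; ring
  have c1 : Complex.log (-Complex.I * p.im + (w - p.re)) =
      Complex.log (1 * p.re + (p.im * Complex.I - w)) + Real.pi * Complex.I := by
    have : -Complex.I * p.im + (w - p.re) = -(1 * p.re + (p.im * Complex.I - w)) := by ring
    rw [this, Complex.log, Complex.log, Complex.arg_neg_eq_arg_add_pi_of_im_neg, norm_neg]
    · push_cast; ring
    · simp; linarith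
  have c2 : Complex.log (-Complex.I * q.im + (w - p.re)) =
      Complex.log (1 * p.re + (q.im * Complex.I - w)) - Real.pi * Complex.I := by
    have : -Complex.I * q.im + (w - p.re) = -(1 * p.re + (q.im * Complex.I - w)) := by ring
    rw [this, Complex.log, Complex.log, Complex.arg_neg_eq_arg_sub_pi_of_im_pos, norm_neg]
    · push_cast; ring
    · simp; linarith
  have c3 : Complex.I * p.im + (q.re - w) = 1 * q.re + (p.im * Complex.I - w) := by ring
  have c4 : Complex.I * q.im + (q.re - w) = 1 * q.re + (q.im * Complex.I - w) := by ring
  rw [c1, c2] at e4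
  rw [c3, c4] at e3
  simp only [rectangleIntegral, smul_eq_mul]
  rw [i1, i2, i3, i4]
  linear_combination e1 - e2 + e3 - e4

/-- Cauchy's integral formula for a rectangle. -/
lemma rectangleIntegral_mul_inv_sub {G : Set ℂ} (hG : IsOpen G) {f : ℂ → ℂ}
    (hf : DifferentiableOn ℂ f G) (hpq : Set.Icc p.re q.re ×ℂ Set.Icc p.im q.im ⊆ G) {w : ℂ}
    (hw : w ∈ Set.Ioo p.re q.re ×ℂ Set.Ioo p.im q.im) :
    rectangleIntegral (fun z => f z * (z - w)⁻¹) p q = 2 * Real.pi * Complex.I * f w := by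
  have hr : p.re < q.re := hw.1.1.trans hw.1.2
  have hi : p.im < q.im := hw.2.1.trans hw.2.2
  have hwG : w ∈ G := hpq ⟨Set.Ioo_subset_Icc_self hw.1, Set.Ioo_subset_Icc_self hw.2⟩
  have hne : ∀ z ∈ rectangleFrame p q, z - w ≠ 0 := by
    rintro z hz h
    exact hz.2 (sub_eq_zero.1 h ▸ hw)
  have hd : DifferentiableOn ℂ (dslope f w) (Set.Icc p.re q.re ×ℂ Set.Icc p.im q.im) :=
    ((Complex.differentiableOn_dslope (hG.mem_nhds hwG)).2 hf).mono hpq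
  have h0 : rectangleIntegral (dslope f w) p q = 0 := by
    refine Complex.integral_boundary_rect_eq_zero_of_differentiableOn _ p q ?_
    rwa [Set.uIcc_of_le hr.le, Set.uIcc_of_le hi.le]
  have hinv : ContinuousOn (fun z => (z - w)⁻¹) (rectangleFrame p q) :=
    ContinuousOn.inv₀ (by fun_prop) hne
  have h1 := ContinuousLinearMap.map_rectangleIntegral
    (ContinuousLinearMap.mul ℂ ℂ (f w)) hr hi hinv
  rw [rectangleIntegral_inv_sub hw] at h1
  simp only [ContinuousLinearMap.mul_apply'] at h1
  rw [mul_comm, h1, ← zero_add (rectangleIntegral (fun z => f w * (z - w)⁻¹) p q), ← h0,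
    ← rectangleIntegral_add hr hi (hd.continuousOn.mono Set.sdiff_subset)
      (show ContinuousOn (fun z => f w * (z - w)⁻¹) _ from continuousOn_const.mul hinv)]
  refine rectangleIntegral_congr hr hi fun z hz => ?_
  have hz' := hne z hz
  rw [dslope_of_ne _ (sub_ne_zero.1 hz'), slope_def_field]
  field_simp
  ring

end RectangleIntegral

/-! ### Rectangles around a compact real interval -/

lemma exists_isSurroundingRectangle {G : Set ℂ} (hG : IsOpen G) {m M : ℝ} (hmM : m ≤ M)
    (h : ∀ x ∈ Set.Icc m M, (x : ℂ) ∈ G) {K : Set ℂ}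
    (hK : K ⊆ (fun x : ℝ => (x : ℂ)) '' Set.Icc m M) :
    ∃ r : ℂ × ℂ, IsSurroundingRectangle G K r.1 r.2 := by
  have hcomp : IsCompact ((fun x : ℝ => (x : ℂ)) '' Set.Icc m M) :=
    isCompact_Icc.image Complex.continuous_ofReal
  obtain ⟨δ, hδ, hsub⟩ :=
    hcomp.exists_thickening_subset_open hG (by rintro _ ⟨x, hx, rfl⟩; exact h x hx)
  refine ⟨(⟨m - δ / 3, -(δ / 3)⟩, ⟨M + δ / 3, δ / 3⟩), ?_, ?_, ?_, ?_⟩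
  · simp only; linarith
  · simp only; linarith
  · rintro z ⟨⟨h1, h2⟩, h3, h4⟩
    simp only at h1 h2 h3 h4
    refine hsub (Metric.mem_thickening_iff.2 ⟨((max m (min M z.re) : ℝ) : ℂ),
      ⟨_, ⟨le_max_left _ _, max_le hmM (min_le_left _ _)⟩, rfl⟩, ?_⟩)
    rw [dist_eq_norm]
    refine (Complex.norm_le_abs_re_add_abs_im _).trans_lt ?_
    have e1 : |(z - ((max m (min M z.re) : ℝ) : ℂ)).re| ≤ δ / 3 := by
      rw [Complex.sub_re, Complex.ofReal_re, abs_le]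
      rcases le_total M z.re with h5 | h5
      · rw [min_eq_left h5, max_eq_right hmM]; constructor <;> linarith
      · rw [min_eq_right h5]
        rcases le_total m z.re with h6 | h6
        · rw [max_eq_right h6]; constructor <;> linarith
        · rw [max_eq_left h6]; constructor <;> linarith
    have e2 : |(z - ((max m (min M z.re) : ℝ) : ℂ)).im| ≤ δ / 3 := by
      rw [Complex.sub_im, Complex.ofReal_im, sub_zero, abs_le]
      exact ⟨h3, h4⟩
    linarith
  · intro z hz
    obtain ⟨x, ⟨h1, h2⟩, rfl⟩ := hK hz
    refine ⟨⟨?_, ?_⟩, ?_, ?_⟩ <;> simp <;> linarith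

/-! ### Characters and the functional calculus -/

lemma continuousOn_smul_resolvent {B : Type*} [NormedRing B] [NormedAlgebra ℂ B]
    [CompleteSpace B] {b : B} {f : ℂ → ℂ} {s : Set ℂ} (hf : ContinuousOn f s)
    (hs : ∀ z ∈ s, z ∉ spectrum ℂ b) :
    ContinuousOn (fun z => f z • Ring.inverse (algebraMap ℂ B z - b)) s := by
  refine hf.smul fun z hz => ?_
  obtain ⟨u, hu⟩ := spectrum.notMem_iff.1 (hs z hz)
  have h1 : ContinuousAt Ring.inverse (algebraMap ℂ B z - b) :=
    hu ▸ NormedRing.inverse_continuousAt u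
  exact (ContinuousAt.comp (f := fun z => algebraMap ℂ B z - b) h1
    (((continuous_algebraMap ℂ B).sub continuous_const).continuousAt)).continuousWithinAt

/-- A character of a commutative Banach algebra sends the Cauchy integral defining `f(b)` to
`f (φ b)`. -/
lemma AlgHom.map_rectangleIntegral_resolvent {B : Type*} [NormedCommRing B] [NormedAlgebra ℂ B]
    [CompleteSpace B] (φ : B →ₐ[ℂ] ℂ) {b : B} {G : Set ℂ} (hG : IsOpen G) {f : ℂ → ℂ}
    (hf : DifferentiableOn ℂ f G) {p q : ℂ} (h : IsSurroundingRectangle G (spectrum ℂ b) p q) :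
    φ ((2 * Real.pi * Complex.I : ℂ)⁻¹ •
      rectangleIntegral (fun z => f z • Ring.inverse (algebraMap ℂ B z - b)) p q) = f (φ b) := by
  have hfr : ∀ z ∈ rectangleFrame p q, z ∉ spectrum ℂ b := fun z hz hzs => hz.2 (h.inside hzs)
  have hcont : ContinuousOn (fun z => f z • Ring.inverse (algebraMap ℂ B z - b))
      (rectangleFrame p q) :=
    continuousOn_smul_resolvent (hf.continuousOn.mono (Set.sdiff_subset.trans h.subset)) hfr
  have hmap := φ.toContinuousLinearMap.map_rectangleIntegral h.re_lt h.im_lt hcont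
  rw [AlgHom.coe_toContinuousLinearMap] at hmap
  rw [map_smul, hmap, rectangleIntegral_congr h.re_lt h.im_lt (g := fun z => f z * (z - φ b)⁻¹),
    rectangleIntegral_mul_inv_sub hG hf h.subset (h.inside (AlgHom.apply_mem_spectrum φ b)),
    smul_eq_mul, inv_mul_cancel_left₀ Complex.two_pi_I_ne_zero]
  intro z hz
  obtain ⟨u, hu⟩ := spectrum.notMem_iff.1 (hfr z hz)
  have hz : φ (u : B) = z - φ b := by rw [hu, map_sub, AlgHom.commutes]; rfl
  simp only [map_smul, smul_eq_mul, ← hu, ← hz, Ring.inverse_unit]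
  congr 1
  refine eq_inv_of_mul_eq_one_left ?_
  rw [← map_mul, Units.inv_mul, map_one]

/-! ### The bicommutant of an element -/

/-- The bicommutant of `c`: the elements commuting with everything that commutes with `c`. -/
def bicommutant {A : Type*} [Ring A] [Algebra ℂ A] (c : A) : Subalgebra ℂ A :=
  Subalgebra.centralizer ℂ (Set.centralizer {c})

section Bicommutant

variable {A : Type*} [Ring A] [Algebra ℂ A] {c : A}

lemma mem_bicommutant {x : A} :
    x ∈ bicommutant c ↔ ∀ y, c * y = y * c → y * x = x * y := by
  simp [bicommutant, Subalgebra.mem_centralizer_iff, Set.mem_centralizer_iff]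

lemma self_mem_bicommutant (c : A) : c ∈ bicommutant c :=
  mem_bicommutant.2 fun _ hy => hy.symm

lemma mul_comm_of_mem_bicommutant {x y : A} (hx : x ∈ bicommutant c) (hy : y ∈ bicommutant c) :
    x * y = y * x :=
  mem_bicommutant.1 hy x (mem_bicommutant.1 hx c rfl)

lemma star_mem_bicommutant [StarRing A] (hc : IsSelfAdjoint c) {x : A} (hx : x ∈ bicommutant c) :
    star x ∈ bicommutant c := by
  refine mem_bicommutant.2 fun y hy => ?_
  have h := mem_bicommutant.1 hx (star y) (by
    have := congrArg star hy
    rw [star_mul, star_mul, hc.star_eq] at this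
    exact this.symm)
  have := congrArg star h
  rw [star_mul, star_mul, star_star] at this
  exact this.symm

/-- The bicommutant is closed under inverses, so that passing to it does not change spectra. -/
lemma isUnit_coe_bicommutant_iff {x : bicommutant c} : IsUnit (x : A) ↔ IsUnit x := by
  refine ⟨fun ⟨u, hu⟩ => ?_, fun h => h.map (bicommutant c).val⟩
  have hmem : (↑u⁻¹ : A) ∈ bicommutant c := by
    refine mem_bicommutant.2 fun y hy => ?_
    have h := mem_bicommutant.1 x.2 y hy
    rw [← hu] at h
    exact (Commute.units_inv_right (show Commute y u from h)).eq
  exact ⟨⟨x, ⟨_, hmem⟩, Subtype.ext (by simp [← hu]), Subtype.ext (by simp [← hu])⟩, rfl⟩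

lemma spectrum_coe_bicommutant (x : bicommutant c) : spectrum ℂ (x : A) = spectrum ℂ x := by
  ext z
  simp only [spectrum.mem_iff, ← isUnit_coe_bicommutant_iff]
  rfl

end Bicommutant

section NormedBicommutant

variable {A : Type*} [NormedRing A] [NormedAlgebra ℂ A] {c : A}

/-- The bicommutant is commutative, as it contains `c` and hence lies in the commutant of `c`. -/
instance : NormedCommRing (bicommutant c) :=
  { (inferInstance : NormedRing (bicommutant c)) with
    mul_comm := fun x y => Subtype.ext (mul_comm_of_mem_bicommutant x.2 y.2) }

instance [CompleteSpace A] : CompleteSpace (bicommutant c) :=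
  (Set.isClosed_centralizer (Set.centralizer {c})).completeSpace_coe

/-- The functional calculus of `c` takes values in the bicommutant of `c`, and the characters of
the bicommutant act on it by evaluation. -/
lemma exists_mem_bicommutant_holomorphicCalculus [CompleteSpace A] {G : Set ℂ} (hG : IsOpen G)
    {f : ℂ → ℂ} (hf : DifferentiableOn ℂ f G)
    (h : ∃ r : ℂ × ℂ, IsSurroundingRectangle G (spectrum ℂ c) r.1 r.2) :
    ∃ u : bicommutant c, (u : A) = holomorphicCalculus G f c ∧
      ∀ φ : bicommutant c →ₐ[ℂ] ℂ, φ u = f (φ ⟨c, self_mem_bicommutant c⟩) := by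
  set b : bicommutant c := ⟨c, self_mem_bicommutant c⟩
  set r := h.choose
  have hrect : IsSurroundingRectangle G (spectrum ℂ b) r.1 r.2 := by
    rw [← spectrum_coe_bicommutant]; exact h.choose_spec
  have hfr : ∀ z ∈ rectangleFrame r.1 r.2, z ∉ spectrum ℂ b :=
    fun z hz hzs => hz.2 (hrect.inside hzs)
  -- The defining integral is taken inside the bicommutant and then mapped to `A`.
  refine ⟨(2 * Real.pi * Complex.I : ℂ)⁻¹ • rectangleIntegral
    (fun z => f z • Ring.inverse (algebraMap ℂ (bicommutant c) z - b)) r.1 r.2, ?_,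
    fun φ => φ.map_rectangleIntegral_resolvent hG hf hrect⟩
  let ι : bicommutant c →L[ℂ] A := ⟨(bicommutant c).val.toLinearMap, continuous_subtype_val⟩
  have hmap := ι.map_rectangleIntegral hrect.re_lt hrect.im_lt
    (continuousOn_smul_resolvent
      (hf.continuousOn.mono (Set.sdiff_subset.trans hrect.subset)) hfr)
  rw [holomorphicCalculus, dif_pos h]
  change ι ((_ : ℂ) • _) = _
  rw [map_smul, hmap]
  congr 1
  refine rectangleIntegral_congr hrect.re_lt hrect.im_lt fun z hz => ?_
  obtain ⟨u, hu⟩ := spectrum.notMem_iff.1 (hfr z hz)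
  have hu' : algebraMap ℂ A z - c = (Units.map (bicommutant c).val.toMonoidHom u : Aˣ) := by
    change _ = ((u : bicommutant c) : A)
    rw [hu]; rfl
  simp only [← hu, hu', Ring.inverse_unit]
  rfl

/-- An element of the bicommutant of a selfadjoint element which is nonnegative under all
characters need not be selfadjoint, as the involution may be discontinuous. But its real part is
nonnegative and its imaginary part has spectrum `{0}`, so a positive functional does not see the
latter. -/
lemma IsPositiveFunctional.nonneg_of_characters [CompleteSpace A] [StarRing A] [StarModule ℂ A]
    (hA : IsHermitianAlgebra A) {ψ : A →ₗ[ℂ] ℂ} (hψ : IsPositiveFunctional ψ)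
    (hc : IsSelfAdjoint c) {u : bicommutant c}
    (hu : ∀ φ : bicommutant c →ₐ[ℂ] ℂ, 0 ≤ (φ u).re ∧ (φ u).im = 0) :
    0 ≤ (ψ u).re ∧ (ψ u).im = 0 := by
  have hmem := star_mem_bicommutant hc u.2
  set v : bicommutant c := ⟨star (u : A), hmem⟩ with hv
  set x : bicommutant c := (2⁻¹ : ℂ) • (u + v) with hx
  set y : bicommutant c := (-(2⁻¹ * Complex.I) : ℂ) • (u - v) with hy
  have hxs : IsSelfAdjoint (x : A) := by
    simp [IsSelfAdjoint, hx, hv, add_comm]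
  have hys : IsSelfAdjoint (y : A) := by
    simp [IsSelfAdjoint, hy, hv, ← smul_neg]
  have huxy : u = x + Complex.I • y := by
    rw [hx, hy, smul_smul, mul_neg, mul_left_comm, Complex.I_mul_I]
    module
  have hreal : ∀ w : bicommutant c, IsSelfAdjoint (w : A) → ∀ φ : bicommutant c →ₐ[ℂ] ℂ,
      (φ w).im = 0 := fun w hw φ => hA _ hw _ <| by
    rw [spectrum_coe_bicommutant]; exact AlgHom.apply_mem_spectrum φ w
  have hφ : ∀ φ : bicommutant c →ₐ[ℂ] ℂ, φ u = φ x + Complex.I * φ y := fun φ => by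
    conv_lhs => rw [huxy]
    simp
  have hφy : ∀ φ : bicommutant c →ₐ[ℂ] ℂ, φ y = 0 := fun φ => by
    have h1 := (hu φ).2
    simp only [hφ φ, Complex.add_im, hreal x hxs φ, Complex.I_mul_im, zero_add] at h1
    exact Complex.ext h1 (hreal y hys φ)
  have hnonneg : ∀ w : bicommutant c, IsSelfAdjoint (w : A) →
      (∀ φ : bicommutant c →ₐ[ℂ] ℂ, 0 ≤ (φ w).re) → IsNonnegElement (w : A) := by
    refine fun w hw h => ⟨hw, fun z hz => ⟨?_, hA _ hw z hz⟩⟩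
    rw [spectrum_coe_bicommutant] at hz
    obtain ⟨χ, rfl⟩ := WeakDual.CharacterSpace.mem_spectrum_iff_exists.1 hz
    exact h (WeakDual.CharacterSpace.equivAlgHom χ)
  have px := hψ x (hnonneg x hxs fun φ => by
    have := (hu φ).1
    rwa [hφ φ, hφy φ, mul_zero, add_zero] at this)
  have py := hψ y (hnonneg y hys fun φ => by rw [hφy φ]; rfl)
  have py' := hψ (-y : bicommutant c) (hnonneg (-y) (by simpa using hys.neg) fun φ => by
    simp [hφy φ])
  have hψy : ψ y = 0 := by
    simp only [NegMemClass.coe_neg, map_neg, Complex.neg_re, Left.nonneg_neg_iff] at py'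
    exact Complex.ext (le_antisymm py'.1 py.1) py.2
  have : ψ u = ψ x := by
    rw [huxy]
    simp [hψy]
  rwa [this]

end NormedBicommutant

/-! ### Positive functionals and the functional calculus -/

section AffineBounds

variable {A : Type*} [NormedRing A] [NormedAlgebra ℂ A] [CompleteSpace A] [StarRing A]
  [StarModule ℂ A] {ψ : A →ₗ[ℂ] ℂ} {G : Set ℂ} {f : ℂ → ℂ} {m M : ℝ} {c : A}

/-- A positive functional preserves every inequality `0 ≤ α + β t + κ f(t)` between real functions
on an interval that contains the spectrum. -/
lemma IsPositiveFunctional.nonneg_affine_add_holomorphicCalculus (hA : IsHermitianAlgebra A)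
    (hψ : IsPositiveFunctional ψ) (hψ1 : ψ 1 = 1) (hG : IsOpen G) (hf : DifferentiableOn ℂ f G)
    (hmM : m ≤ M) (hmMG : ∀ x ∈ Set.Icc m M, (x : ℂ) ∈ G)
    (hfreal : ∀ x ∈ Set.Icc m M, (f x).im = 0) (hc : IsSelfAdjoint c)
    (hspec : spectrum ℂ c ⊆ (fun x : ℝ => (x : ℂ)) '' Set.Icc m M) (α β κ : ℝ)
    (h : ∀ x ∈ Set.Icc m M, 0 ≤ α + β * x + κ * onReal f x) :
    0 ≤ (α + β * ψ c + κ * ψ (holomorphicCalculus G f c)).re ∧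
      (α + β * ψ c + κ * ψ (holomorphicCalculus G f c)).im = 0 := by
  obtain ⟨u, hu, hφu⟩ := exists_mem_bicommutant_holomorphicCalculus hG hf
    (exists_isSurroundingRectangle hG hmM hmMG hspec)
  set b : bicommutant c := ⟨c, self_mem_bicommutant c⟩ with hb
  have key := hψ.nonneg_of_characters hA hc
    (u := algebraMap ℂ (bicommutant c) α + (β : ℂ) • b + (κ : ℂ) • u) fun φ => by
      obtain ⟨x, hx, hxφ⟩ := hspec (by
        change φ b ∈ spectrum ℂ (b : A)
        rw [spectrum_coe_bicommutant]
        exact AlgHom.apply_mem_spectrum φ b)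
      have hfx : f x = (onReal f x : ℂ) := Complex.ext rfl (hfreal x hx)
      have : φ (algebraMap ℂ (bicommutant c) α + (β : ℂ) • b + (κ : ℂ) • u) =
          ((α + β * x + κ * onReal f x : ℝ) : ℂ) := by
        rw [map_add, map_add, map_smul, map_smul, AlgHom.commutes, hφu φ, ← hxφ, hfx]
        simp
      rw [this]
      exact ⟨h x hx, Complex.ofReal_im _⟩
  have : ψ (algebraMap ℂ (bicommutant c) α + (β : ℂ) • b + (κ : ℂ) • u : bicommutant c) =
      α + β * ψ c + κ * ψ (holomorphicCalculus G f c) := by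
    have : ((algebraMap ℂ (bicommutant c) α + (β : ℂ) • b + (κ : ℂ) • u : bicommutant c) : A) =
        (α : ℂ) • (1 : A) + (β : ℂ) • c + (κ : ℂ) • holomorphicCalculus G f c := by
      rw [← hu, ← Algebra.algebraMap_eq_smul_one]; rfl
    rw [this]
    simp [hψ1]
  rwa [this] at key

end AffineBounds

/-! ### Chords of convex functions -/

section Chords

variable {g : ℝ → ℝ} {m M t : ℝ}

lemma chordSlopeDiff_nonneg (hg : ConvexOn ℝ (Set.Icc m M) g) (ht : t ∈ Set.Ioo m M) :
    0 ≤ chordSlopeDiff g m M t := by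
  have hmM := (ht.1.trans ht.2).le
  exact sub_nonneg.2 (hg.slope_mono_adjacent (Set.left_mem_Icc.2 hmM) (Set.right_mem_Icc.2 hmM)
    ht.1 ht.2)

lemma chordSlopeDiff_le (hg : ConvexOn ℝ (Set.Icc m M) g) (hm : DifferentiableAt ℝ g m)
    (hM : DifferentiableAt ℝ g M) (ht : t ∈ Set.Ioo m M) :
    chordSlopeDiff g m M t ≤ deriv g M - deriv g m := by
  have hmM := (ht.1.trans ht.2).le
  have h1 := hg.slope_le_of_hasDerivAt ⟨ht.1.le, ht.2.le⟩ (Set.right_mem_Icc.2 hmM) ht.2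
    hM.hasDerivAt
  have h2 := hg.le_slope_of_hasDerivAt (Set.left_mem_Icc.2 hmM) ⟨ht.1.le, ht.2.le⟩ ht.1
    hm.hasDerivAt
  rw [slope_def_field] at h1 h2
  exact sub_le_sub h1 h2

/-- The value at `t` of the chord over `[m, M]` exceeds `g t` by a multiple of the difference of
the two chord slopes at `t`. -/
lemma chord_sub_eq (ht : t ∈ Set.Ioo m M) :
    g m + (g M - g m) / (M - m) * (t - m) - g t =
      (M - t) * (t - m) / (M - m) * chordSlopeDiff g m M t := by
  have h1 : M - t ≠ 0 := (sub_pos.2 ht.2).ne'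
  have h2 : t - m ≠ 0 := (sub_pos.2 ht.1).ne'
  have h3 : M - m ≠ 0 := (sub_pos.2 (ht.1.trans ht.2)).ne'
  rw [chordSlopeDiff]
  field_simp
  ring

lemma le_chord (hg : ConvexOn ℝ (Set.Icc m M) g) (ht : t ∈ Set.Icc m M) (hmM : m < M) :
    g t ≤ g m + (g M - g m) / (M - m) * (t - m) := by
  rcases eq_or_lt_of_le ht.1 with rfl | h1
  · simp
  rcases eq_or_lt_of_le ht.2 with rfl | h2
  · rw [div_mul_cancel₀ _ (sub_pos.2 hmM).ne']; linarith
  rw [← sub_nonneg, chord_sub_eq ⟨h1, h2⟩]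
  have := chordSlopeDiff_nonneg hg ⟨h1, h2⟩
  have := sub_pos.2 h1
  have := sub_pos.2 h2
  have := sub_pos.2 hmM
  positivity

lemma tangent_le (hg : ConvexOn ℝ (Set.Icc m M) g) {s : ℝ} (hs : s ∈ Set.Icc m M)
    (hd : DifferentiableAt ℝ g s) (ht : t ∈ Set.Icc m M) :
    g s + deriv g s * (t - s) ≤ g t := by
  rcases lt_trichotomy s t with h | rfl | h
  · have := hg.le_slope_of_hasDerivAt hs ht h hd.hasDerivAt
    rw [slope_def_field, le_div_iff₀ (sub_pos.2 h)] at this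
    linarith
  · simp
  · have := hg.slope_le_of_hasDerivAt ht hs h hd.hasDerivAt
    rw [slope_def_field, div_le_iff₀ (sub_pos.2 h)] at this
    linarith

end Chords

lemma differentiableAt_onReal {f : ℂ → ℂ} {x : ℝ} (hf : DifferentiableAt ℂ f x) :
    DifferentiableAt ℝ (onReal f) x :=
  hf.hasDerivAt.real_of_complex.differentiableAt

/-! ### The Jensen-type inequalities -/

theorem theorem2p1 {A : Type*} [NormedRing A] [NormedAlgebra ℂ A] [CompleteSpace A]
    [StarRing A] [StarModule ℂ A] (hA : IsHermitianAlgebra A)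
    (ψ : A →ₗ[ℂ] ℂ) (hψ : IsPositiveFunctional ψ) (hψ1 : ψ 1 = 1)
    (G : Set ℂ) (hG : IsOpen G) (f : ℂ → ℂ) (hf : AnalyticOnNhd ℂ f G)
    (I : Set ℝ) (hI : I.OrdConnected) (hIG : ∀ x ∈ I, (x : ℂ) ∈ G)
    (hfreal : ∀ x ∈ I, (f x).im = 0) (hconv : ConvexOn ℝ I (onReal f))
    (m M : ℝ) (hmM : m < M) (hmMI : Set.Icc m M ⊆ I)
    (c : A) (hc : IsSelfAdjoint c)
    (hspec : spectrum ℂ c ⊆ (fun x : ℝ => (x : ℂ)) '' Set.Icc m M)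
    (s : ℝ) (hs : ψ c = (s : ℂ)) (hsmM : s ∈ Set.Ioo m M) :
    ∃ y : ℝ, ψ (holomorphicCalculus G f c) = (y : ℂ) ∧
      BddAbove (chordSlopeDiff (onReal f) m M '' Set.Ioo m M) ∧
      -- first chain
      (0 ≤ y - onReal f s ∧
        y - onReal f s ≤
          (M - s) * (s - m) / (M - m) * supChordSlopeDiff (onReal f) m M ∧
        (M - s) * (s - m) / (M - m) * supChordSlopeDiff (onReal f) m M ≤
          1 / 4 * (M - m) * supChordSlopeDiff (onReal f) m M ∧
        (M - s) * (s - m) / (M - m) * supChordSlopeDiff (onReal f) m M ≤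
          (M - s) * (s - m) * ((deriv (onReal f) M - deriv (onReal f) m) / (M - m)) ∧
        1 / 4 * (M - m) * supChordSlopeDiff (onReal f) m M ≤
          1 / 4 * (M - m) * (deriv (onReal f) M - deriv (onReal f) m) ∧
        (M - s) * (s - m) * ((deriv (onReal f) M - deriv (onReal f) m) / (M - m)) ≤
          1 / 4 * (M - m) * (deriv (onReal f) M - deriv (onReal f) m)) ∧
      -- second chain
      (0 ≤ y - onReal f s ∧
        y - onReal f s ≤ 1 / 4 * (M - m) * chordSlopeDiff (onReal f) m M s ∧
        1 / 4 * (M - m) * chordSlopeDiff (onReal f) m M s ≤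
          1 / 4 * (M - m) * supChordSlopeDiff (onReal f) m M ∧
        1 / 4 * (M - m) * supChordSlopeDiff (onReal f) m M ≤
          1 / 4 * (M - m) * (deriv (onReal f) M - deriv (onReal f) m)) := by
  set g := onReal f with hg
  have hfd : DifferentiableOn ℂ f G := hf.differentiableOn
  have hGm : ∀ x ∈ Set.Icc m M, (x : ℂ) ∈ G := fun x hx => hIG x (hmMI hx)
  have hgd : ∀ x ∈ Set.Icc m M, DifferentiableAt ℝ g x := fun x hx =>
    differentiableAt_onReal (hfd.differentiableAt (hG.mem_nhds (hGm x hx)))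
  have hgc : ConvexOn ℝ (Set.Icc m M) g := hconv.subset hmMI (convex_Icc m M)
  have hsI : s ∈ Set.Icc m M := ⟨hsmM.1.le, hsmM.2.le⟩
  have haff := hψ.nonneg_affine_add_holomorphicCalculus hA hψ1 hG hfd hmM.le hGm
    (fun x hx => hfreal x (hmMI hx)) hc hspec
  -- The tangent of `g` at `s` lies below `g`, the chord over `[m, M]` above.
  have htan := haff (-(g s - deriv g s * s)) (-deriv g s) 1 fun x hx => by
    linarith [tangent_le hgc hsI (hgd s hsI) hx]
  have hchord := haff (g m - (g M - g m) / (M - m) * m) ((g M - g m) / (M - m)) (-1) fun x hx => by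
    linarith [le_chord hgc hx hmM]
  rw [hs] at htan hchord
  obtain ⟨y, hy⟩ : ∃ y : ℝ, ψ (holomorphicCalculus G f c) = (y : ℂ) := by
    refine ⟨_, Complex.ext (Complex.ofReal_re _).symm ?_⟩
    simpa using htan.2
  rw [hy] at htan hchord
  simp only [← Complex.ofReal_mul, ← Complex.ofReal_add, Complex.ofReal_re] at htan hchord
  have hlow : 0 ≤ y - g s := by linarith [htan.1]
  have hup : y - g s ≤ (M - s) * (s - m) / (M - m) * chordSlopeDiff g m M s := by
    rw [← chord_sub_eq hsmM]; linarith [hchord.1]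
  have hbdd : BddAbove (chordSlopeDiff g m M '' Set.Ioo m M) := by
    refine ⟨deriv g M - deriv g m, ?_⟩
    rintro _ ⟨t, ht, rfl⟩
    exact chordSlopeDiff_le hgc (hgd m (Set.left_mem_Icc.2 hmM.le))
      (hgd M (Set.right_mem_Icc.2 hmM.le)) ht
  have hsup : chordSlopeDiff g m M s ≤ supChordSlopeDiff g m M :=
    le_csSup hbdd ⟨s, hsmM, rfl⟩
  have hsup' : supChordSlopeDiff g m M ≤ deriv g M - deriv g m := by
    refine csSup_le ⟨_, s, hsmM, rfl⟩ ?_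
    rintro _ ⟨t, ht, rfl⟩
    exact chordSlopeDiff_le hgc (hgd m (Set.left_mem_Icc.2 hmM.le))
      (hgd M (Set.right_mem_Icc.2 hmM.le)) ht
  have h0 := chordSlopeDiff_nonneg hgc hsmM
  have hMm : 0 < M - m := sub_pos.2 hmM
  have hw0 : 0 ≤ (M - s) * (s - m) / (M - m) :=
    div_nonneg (mul_nonneg (sub_nonneg.2 hsI.2) (sub_nonneg.2 hsI.1)) hMm.le
  -- The arithmetic-geometric mean inequality for `M - s` and `s - m`.
  have hw : (M - s) * (s - m) / (M - m) ≤ 1 / 4 * (M - m) := by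
    rw [div_le_iff₀ hMm]
    nlinarith [sq_nonneg ((M - s) - (s - m))]
  have hquart : 0 ≤ 1 / 4 * (M - m) := by linarith
  have hrw : (M - s) * (s - m) * ((deriv g M - deriv g m) / (M - m)) =
      (M - s) * (s - m) / (M - m) * (deriv g M - deriv g m) := by ring
  have hlast : 1 / 4 * (M - m) * supChordSlopeDiff g m M ≤
      1 / 4 * (M - m) * (deriv g M - deriv g m) := mul_le_mul_of_nonneg_left hsup' hquart
  rw [hrw]
  refine ⟨y, hy, hbdd, ⟨hlow, hup.trans (mul_le_mul_of_nonneg_left hsup hw0),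
    mul_le_mul_of_nonneg_right hw (h0.trans hsup), mul_le_mul_of_nonneg_left hsup' hw0, hlast,
    mul_le_mul_of_nonneg_right hw ((h0.trans hsup).trans hsup')⟩, hlow,
    hup.trans (mul_le_mul_of_nonneg_right hw h0), mul_le_mul_of_nonneg_left hsup hquart, hlast⟩
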